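/- All modules are right modules. Let $R$ be an associative unital ring. A right $R$-module $M$ is called \emph{$R$-projective} if for every right ideal $I$ of $R$, every homomorphism $M \to R/I$ factors through the canonical projection $R \to R/I$. The module $M$ is \emph{non-singular} if $0$ is the only element $m \in M$ whose annihilator $\{r \in R \mid mr = 0\}$ is an essential right ideal of $R$. A ring is \emph{artinian} if it is both left and right artinian, and $R$ \emph{has primitive factors artinian} if $R/P$ is artinian for every (right) primitive ideal $P$ of $R$, i.e., for every annihilator $P$ of a simple right $R$-module. Let $R$ be a right self-injective von Neumann regular ring which has primitive factors artinian, but is not artinian. Then: (1) every $R$-projective right $R$-module is non-singular; (2) the Dual Baer Criterion holds for all countably generated right $R$-modules: a countably generated right $R$-module is projective if and only if it is $R$-projective. Moreover, every direct product $\prod_{i \in \iota} D_i$ of skew-fields $D_i$ over an infinite index set $\iota$ is a ring satisfying the above assumptions on $R$. -/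

import Mathlib

namespace DualBaer

universe u v

/-! Right `R`-modules are modules over `Rᵐᵒᵖ`; right ideals of `R` are the `Rᵐᵒᵖ`-submodules
of `R`, where `MulOpposite.op r • x = x * r`. -/

/-- A ring is von Neumann regular if every element `a` has some `b` with `a * b * a = a`. -/
def IsVonNeumannRegular (R : Type u) [Ring R] : Prop :=
  ∀ a : R, ∃ b : R, a * b * a = a

/-- A ring is right self-injective if it is injective as a right module over itself. -/
def IsRightSelfInjective (R : Type u) [Ring R] : Prop :=
  Module.Injective Rᵐᵒᵖ R

/-- A ring is artinian if it is both left artinian and right artinian. -/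
def IsTwoSidedArtinian (R : Type u) [Ring R] : Prop :=
  IsArtinian R R ∧ IsArtinian Rᵐᵒᵖ R

/-- A two-sided ideal is (right) primitive if it is the annihilator of a simple right module.
Simple right modules are quotients of `R`, so those in the universe of `R` suffice. -/
def IsRightPrimitive {R : Type u} [Ring R] (P : TwoSidedIdeal R) : Prop :=
  ∃ (S : Type u) (_ : AddCommGroup S) (_ : Module Rᵐᵒᵖ S), IsSimpleModule Rᵐᵒᵖ S ∧
    ∀ r : R, r ∈ P ↔ ∀ s : S, MulOpposite.op r • s = 0

/-- All factor rings `R/P`, with `P` a (right) primitive ideal, are artinian. -/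
def HasPrimitiveFactorsArtinian (R : Type u) [Ring R] : Prop :=
  ∀ P : TwoSidedIdeal R, IsRightPrimitive P → IsTwoSidedArtinian P.ringCon.Quotient

/-- Right self-injective von Neumann regular rings that have primitive factors artinian but are
not artinian. -/
structure IsNonArtinianRegularSelfInjective (R : Type u) [Ring R] : Prop where
  selfInjective : IsRightSelfInjective R
  regular : IsVonNeumannRegular R
  primitiveFactorsArtinian : HasPrimitiveFactorsArtinian R
  notArtinian : ¬ IsTwoSidedArtinian R

/-- A right module `M` is `R`-projective if, for every right ideal `I` of `R`, every homomorphism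
`M → R/I` factors through the canonical projection `R → R/I`. -/
def IsRProjective (R : Type u) [Ring R] (M : Type v) [AddCommGroup M] [Module Rᵐᵒᵖ M] : Prop :=
  ∀ (I : Submodule Rᵐᵒᵖ R) (f : M →ₗ[Rᵐᵒᵖ] R ⧸ I), ∃ g : M →ₗ[Rᵐᵒᵖ] R, I.mkQ ∘ₗ g = f

/-- A right ideal is essential if it meets every nonzero right ideal nontrivially. -/
def IsEssentialRightIdeal {R : Type u} [Ring R] (I : Submodule Rᵐᵒᵖ R) : Prop :=
  ∀ J : Submodule Rᵐᵒᵖ R, I ⊓ J = ⊥ → J = ⊥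

/-- The annihilator `{r | m r = 0}` of an element of a right module, as a right ideal. -/
def annRightIdeal (R : Type u) [Ring R] {M : Type v} [AddCommGroup M] [Module Rᵐᵒᵖ M]
    (m : M) : Submodule Rᵐᵒᵖ R where
  carrier := {r | MulOpposite.op r • m = 0}
  add_mem' := by
    intro a b ha hb
    simp only [Set.mem_ofPred_eq] at ha hb ⊢
    rw [MulOpposite.op_add, add_smul, ha, hb, add_zero]
  zero_mem' := by simp
  smul_mem' := by
    intro c x hx
    simp only [Set.mem_ofPred_eq] at hx ⊢
    have h : MulOpposite.op (c • x) = c * MulOpposite.op x := rfl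
    rw [h, mul_smul, hx, smul_zero]

/-- A right module is non-singular if its singular submodule, which consists of the elements
whose annihilator is an essential right ideal, is zero. -/
def IsNonsingularRightModule (R : Type u) [Ring R] (M : Type v) [AddCommGroup M]
    [Module Rᵐᵒᵖ M] : Prop :=
  ∀ m : M, IsEssentialRightIdeal (annRightIdeal R m) → m = 0

/-- A right module is countably generated if it is spanned by a countable subset. -/
def IsCountablyGenerated (R : Type u) [Ring R] (M : Type v) [AddCommGroup M]
    [Module Rᵐᵒᵖ M] : Prop :=
  ∃ S : Set M, S.Countable ∧ Submodule.span Rᵐᵒᵖ S = ⊤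

end DualBaer

/-!
Right `R`-modules are treated as left modules over `A = Rᵐᵒᵖ`, which is regular and left
self-injective.

A simple module `S` over a regular ring whose primitive factors are artinian is injective
(`baer_of_hasPrimitiveFactorsArtinian`): the annihilator `P` of `S` is already the annihilator of
finitely many elements, so `R / P` embeds in a finite power of `S`, and by regularity a
homomorphism from a one-sided ideal `I` to `S` vanishes on `I ∩ P`. Now let `M` be `R`-projective
and `m : M` singular and nonzero. Some simple quotient `R ⧸ J` of the submodule generated by `m` is
injective, so there is `f : M → R ⧸ J` with `f m ≠ 0`. It factors through a homomorphism
`M → R`, but such homomorphisms kill `m` because `R` is non-singular. This contradiction shows that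
`M` is non-singular.

For projectivity, let `M` be countably generated and non-singular. Each left ideal of `A` is
essential in one generated by an idempotent (`exists_essential_hull`), so annihilators of elements
of `M` are generated by idempotents, and each `c : M` has a functional `t : M → A` with
`t c • c = c` (`exists_functional_smul_eq`). Such functionals allow one to correct a partial section
of the canonical map from a free module onto `M` at one more generator at a time, which
produces a section in the limit (`projective_of_exists_functional_smul_eq`).

In a product of skew-fields every `x` has a pointwise inverse `x⁻¹` (with `0⁻¹ = 0`), and
`x * x⁻¹` is a central idempotent; hence primitive factors are skew-fields. Self-injectivity follows
coordinatewise from Baer's criterion.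
-/

namespace DualBaer

universe u v

/-! ### Essential submodules and regular rings -/

/-- A submodule is essential if it meets every nonzero submodule nontrivially. -/
def IsEssential {A M : Type*} [Ring A] [AddCommGroup M] [Module A M] (N : Submodule A M) : Prop :=
  ∀ J : Submodule A M, N ⊓ J = ⊥ → J = ⊥

theorem IsEssential.mono {A M : Type*} [Ring A] [AddCommGroup M] [Module A M]
    {N N' : Submodule A M} (h : IsEssential N) (hle : N ≤ N') : IsEssential N' := fun J hJ =>
  h J (le_bot_iff.1 ((inf_le_inf_right J hle).trans hJ.le))

theorem IsEssential.comap_equiv {A M M' : Type*} [Ring A] [AddCommGroup M] [Module A M]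
    [AddCommGroup M'] [Module A M'] (e : M ≃ₗ[A] M') {N : Submodule A M'} (h : IsEssential N) :
    IsEssential (N.comap (e : M →ₗ[A] M')) := by
  intro J hJ
  have key : J.map (e : M →ₗ[A] M') = ⊥ := by
    refine h _ (le_bot_iff.1 ?_)
    rintro _ ⟨hy, x, hx, rfl⟩
    have : x ∈ N.comap (e : M →ₗ[A] M') ⊓ J := ⟨hy, hx⟩
    rw [hJ, Submodule.mem_bot] at this
    simp [this]
  exact Submodule.map_eq_bot_iff.1 key

theorem IsVonNeumannRegular.op {R : Type*} [Ring R] (h : IsVonNeumannRegular R) :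
    IsVonNeumannRegular Rᵐᵒᵖ := fun a => by
  obtain ⟨b, hb⟩ := h a.unop
  exact ⟨MulOpposite.op b, MulOpposite.unop_injective (by simpa [mul_assoc] using hb)⟩

/-- A regular ring is non-singular: with `y = y * b * y`, an essential left ideal that kills `y`
from the left meets the left ideal generated by `y * b` trivially. -/
theorem IsVonNeumannRegular.eq_zero_of_essential {A : Type*} [Ring A] (hA : IsVonNeumannRegular A)
    {I : Ideal A} (hI : IsEssential I) {y : A} (h : ∀ a ∈ I, a * y = 0) : y = 0 := by
  obtain ⟨b, hb⟩ := hA y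
  have hspan : Ideal.span {y * b} = ⊥ := by
    refine hI _ (le_bot_iff.1 ?_)
    rintro x ⟨hxI, hx⟩
    obtain ⟨r, rfl⟩ := Ideal.mem_span_singleton'.1 hx
    have h1 := h _ hxI
    have h2 : r * y = 0 := by rwa [mul_assoc, hb] at h1
    rw [Submodule.mem_bot, ← mul_assoc, h2, zero_mul]
  rw [Ideal.span_singleton_eq_bot] at hspan
  rw [← hb, hspan, zero_mul]

/-- Homomorphisms to a regular ring kill the singular submodule. -/
theorem IsVonNeumannRegular.map_eq_zero_of_essential {A M : Type*} [Ring A] [AddCommGroup M]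
    [Module A M] (hA : IsVonNeumannRegular A) (f : M →ₗ[A] A) {m : M}
    (hm : IsEssential (Ideal.torsionOf A M m)) : f m = 0 :=
  hA.eq_zero_of_essential hm fun a ha => by
    rw [← smul_eq_mul, ← map_smul, (Ideal.mem_torsionOf_iff m a).1 ha, map_zero]

/-! ### Extending homomorphisms from cyclic submodules -/

theorem _root_.Module.Baer.exists_map_eq {A M Q : Type*} [Ring A] [AddCommGroup M] [Module A M]
    [AddCommGroup Q] [Module A Q] (hQ : Module.Baer A Q) {m : M} {q : Q}
    (h : Ideal.torsionOf A M m ≤ Ideal.torsionOf A Q q) : ∃ f : M →ₗ[A] Q, f m = q := by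
  let i := (Ideal.torsionOf A M m).liftQ (LinearMap.toSpanSingleton A M m) le_rfl
  let g := (Ideal.torsionOf A M m).liftQ (LinearMap.toSpanSingleton A Q q) h
  have hi : Function.Injective i := by
    rw [← LinearMap.ker_eq_bot]
    exact Submodule.ker_liftQ_eq_bot _ _ _ le_rfl
  obtain ⟨f, hf⟩ := hQ.extension_property i hi g
  refine ⟨f, ?_⟩
  have h1 : f ((1 : A) • m) = (1 : A) • q := LinearMap.congr_fun hf (Submodule.Quotient.mk 1)
  rwa [one_smul, one_smul] at h1

theorem exists_maximal_inf_eq_bot {A M : Type*} [Ring A] [AddCommGroup M] [Module A M]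
    (I : Submodule A M) :
    ∃ J : Submodule A M, I ⊓ J = ⊥ ∧ ∀ K, J ≤ K → I ⊓ K = ⊥ → K ≤ J := by
  obtain ⟨J, -, hJ⟩ := zorn_le_nonempty₀ {J : Submodule A M | I ⊓ J = ⊥} (fun c hc hchain y hy => by
    refine ⟨sSup c, le_bot_iff.1 ?_, fun z hz => le_sSup hz⟩
    rintro x ⟨hxI, hx⟩
    obtain ⟨K, hK, hxK⟩ := (Submodule.mem_sSup_of_directed ⟨y, hy⟩ hchain.directedOn).1 hx
    exact (hc hK).le ⟨hxI, hxK⟩) ⊥ (inf_bot_eq I)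
  exact ⟨J, hJ.prop, fun K hJK hK => hJ.le_of_ge hK hJK⟩

/-- In a self-injective regular ring every left ideal `I` is essential in a left ideal generated
by an idempotent `e`. Of this only two consequences are recorded: right multiplication by `e` fixes
`I`, and `e` is a singular element modulo `I`. -/
theorem exists_essential_hull {A : Type*} [Ring A] (hA : IsVonNeumannRegular A)
    (hinj : Module.Baer A A) (I : Ideal A) :
    ∃ e : A, (∀ x ∈ I, x * e = x) ∧
      IsEssential (Ideal.torsionOf A (A ⧸ I) (Submodule.Quotient.mk e)) := by
  obtain ⟨J, hIJ, hmax⟩ := exists_maximal_inf_eq_bot I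
  -- The inclusion of `I` extends along the embedding of `I` into `A ⧸ J`; the extension is right
  -- multiplication by an element which fixes `I` and kills `J`.
  obtain ⟨f, hf⟩ := hinj.extension_property (J.mkQ ∘ₗ I.subtype) (by
    rw [← LinearMap.ker_eq_bot, LinearMap.ker_comp, Submodule.ker_mkQ]
    ext x
    constructor
    · intro hx
      have : (x : A) ∈ I ⊓ J := ⟨x.2, hx⟩
      rw [hIJ] at this
      exact Subtype.ext this
    · rintro rfl
      exact zero_mem _) I.subtype
  have hmul : ∀ a : A, a * f (J.mkQ 1) = f (J.mkQ a) := fun a => by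
    rw [← smul_eq_mul, ← map_smul, ← map_smul, smul_eq_mul, mul_one]
  set e := f (J.mkQ 1)
  have heI : ∀ x ∈ I, x * e = x := fun x hx => by
    rw [hmul]
    exact LinearMap.congr_fun hf ⟨x, hx⟩
  have heJ : ∀ x ∈ J, x * e = 0 := fun x hx => by
    rw [hmul, show J.mkQ x = 0 from (Submodule.Quotient.mk_eq_zero J).2 hx, map_zero]
  have hess : IsEssential (I ⊔ J) := by
    intro K hK
    have hd : I ⊓ (J ⊔ K) = ⊥ := disjoint_iff.1
      (Disjoint.disjoint_sup_right_of_disjoint_sup_left (disjoint_iff.2 hIJ) (disjoint_iff.2 hK))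
    have hKJ : K ≤ J := le_sup_right.trans (hmax _ le_sup_left hd)
    rw [← hK]
    exact (inf_eq_right.2 (hKJ.trans le_sup_right)).symm
  have hidem : e * e = e := by
    rw [← sub_eq_zero]
    refine hA.eq_zero_of_essential hess fun a ha => ?_
    obtain ⟨x, hx, y, hy, rfl⟩ := Submodule.mem_sup.1 ha
    rw [add_mul, mul_sub, mul_sub, ← mul_assoc, ← mul_assoc, heI x hx, heI x hx, heJ y hy]
    simp
  refine ⟨e, heI, fun K hK => (Submodule.eq_bot_iff _).2 fun r hr => ?_⟩
  have hmem : ∀ a : A, a ∈ Ideal.torsionOf A (A ⧸ I) (Submodule.Quotient.mk e) ↔ a * e ∈ I :=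
    fun a => by
      rw [Ideal.mem_torsionOf_iff, ← Submodule.Quotient.mk_smul, Submodule.Quotient.mk_eq_zero,
        smul_eq_mul]
  have hdis : ∀ t : A, t * r * e ∈ I → t * r = 0 := fun t ht => by
    have : t * r ∈ Ideal.torsionOf A (A ⧸ I) (Submodule.Quotient.mk e) ⊓ K :=
      ⟨(hmem _).2 ht, K.smul_mem t hr⟩
    rwa [hK, Submodule.mem_bot] at this
  -- The left ideal generated by `r * e` meets `I` trivially, so it lies in `J` by maximality.
  have hreJ : r * e ∈ J := by
    refine hmax (J ⊔ Ideal.span {r * e}) le_sup_left (le_bot_iff.1 ?_)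
      (Submodule.mem_sup_right (Ideal.mem_span_singleton_self _))
    rintro x ⟨hxI, hx⟩
    obtain ⟨j, hj, y, hy, rfl⟩ := Submodule.mem_sup.1 hx
    obtain ⟨t, rfl⟩ := Ideal.mem_span_singleton'.1 hy
    have h1 : j + t * (r * e) = t * r * e := by
      rw [← heI _ hxI, add_mul, heJ j hj, zero_add, mul_assoc, mul_assoc, hidem, mul_assoc]
    rw [h1] at hxI ⊢
    rw [hdis t hxI, zero_mul]
    exact zero_mem _
  have hre : r * e = 0 := by
    have := heJ _ hreJ
    rwa [mul_assoc, hidem] at this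
  simpa using hdis 1 (by simp [hre])

/-- Over a self-injective regular ring, non-singular modules are regular in Zelmanowitz's sense:
every element `c` satisfies `t c • c = c` for some linear functional `t`. -/
theorem exists_functional_smul_eq {A M : Type*} [Ring A] [AddCommGroup M] [Module A M]
    (hA : IsVonNeumannRegular A) (hinj : Module.Baer A A)
    (hM : ∀ m : M, IsEssential (Ideal.torsionOf A M m) → m = 0) (c : M) :
    ∃ t : M →ₗ[A] A, t c • c = c := by
  obtain ⟨e, he, hess⟩ := exists_essential_hull hA hinj (Ideal.torsionOf A M c)
  have hec : e • c = 0 := hM _ <| hess.mono fun r hr => by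
    rw [Ideal.mem_torsionOf_iff, ← Submodule.Quotient.mk_smul, Submodule.Quotient.mk_eq_zero,
      Ideal.mem_torsionOf_iff] at hr
    rw [Ideal.mem_torsionOf_iff, ← mul_smul]
    exact hr
  obtain ⟨t, ht⟩ := hinj.exists_map_eq (m := c) (q := 1 - e) fun x hx => by
    rw [Ideal.mem_torsionOf_iff, smul_eq_mul, mul_sub, mul_one, he x hx, sub_self]
  exact ⟨t, by rw [ht, sub_smul, hec, one_smul, sub_zero]⟩

/-! ### Countably generated regular modules are projective -/

/-- A countably generated module that is regular in Zelmanowitz's sense is projective. The section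
of the canonical map `π` from the free module on `M` is the limit of maps `s n`, where `s (n + 1)`
corrects `s n` so that the `n`-th generator is fixed by `π ∘ s (n + 1)`, and agrees with `s n`
wherever `π ∘ s n` is already the identity. -/
theorem projective_of_exists_functional_smul_eq {A M : Type*} [Ring A] [AddCommGroup M]
    [Module A M] (hreg : ∀ c : M, ∃ t : M →ₗ[A] A, t c • c = c) {S : Set M} (hS : S.Countable)
    (hspan : Submodule.span A S = ⊤) : Module.Projective A M := by
  obtain ⟨x, hx⟩ := Set.countable_iff_exists_subset_range.1 hS
  let π : (M →₀ A) →ₗ[A] M := Finsupp.linearCombination A id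
  have hstep : ∀ (s : M →ₗ[A] M →₀ A) (y : M), ∃ s' : M →ₗ[A] M →₀ A,
      (∀ m, π (s m) = m → s' m = s m) ∧ π (s' y) = y := fun s y => by
    obtain ⟨t, ht⟩ := hreg (y - π (s y))
    refine ⟨s + Finsupp.lsingle (y - π (s y)) ∘ₗ t ∘ₗ (LinearMap.id - π ∘ₗ s),
      fun m hm => by simp [hm], ?_⟩
    have h1 : π (Finsupp.single (y - π (s y)) (t (y - π (s y)))) = y - π (s y) := by
      rw [Finsupp.linearCombination_single, id, ht]
    simp only [LinearMap.add_apply, LinearMap.comp_apply, LinearMap.sub_apply, LinearMap.id_apply,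
      Finsupp.lsingle_apply, map_add] at h1 ⊢
    rw [h1]
    abel
  choose next hnext hfix using hstep
  let s : ℕ → M →ₗ[A] M →₀ A := fun n => Nat.rec 0 (fun k f => next f (x k)) n
  have hs : ∀ n, s (n + 1) = next (s n) (x n) := fun n => rfl
  let K : ℕ → Submodule A M := fun n => LinearMap.eqLocus (π ∘ₗ s n) LinearMap.id
  have hstable : ∀ n m, m ∈ K n → ∀ k, n ≤ k → s k m = s n m := fun n m hm k hk => by
    induction k, hk using Nat.le_induction with
    | base => rfl
    | succ k hk ih =>
      rw [hs, hnext _ _ m, ih]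
      rw [ih]
      exact hm
  have hmono : Monotone K := fun n k hk m hm => by
    change π (s k m) = m
    rw [hstable n m hm k hk]
    exact hm
  have hex : ∀ m, ∃ n, m ∈ K n := fun m => by
    have htop : ⨆ n, K n = ⊤ := by
      rw [eq_top_iff, ← hspan, Submodule.span_le]
      intro y hy
      obtain ⟨n, rfl⟩ := hx hy
      exact Submodule.mem_iSup_of_mem (n + 1) (hfix (s n) (x n))
    rw [← Submodule.mem_iSup_of_directed K hmono.directed_le, htop]
    trivial
  choose N hN using hex
  have heq : ∀ m k, N m ≤ k → s (N m) m = s k m := fun m k hk => (hstable _ m (hN m) k hk).symm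
  rw [Module.projective_def]
  refine ⟨{ toFun := fun m => s (N m) m, map_add' := fun a b => ?_, map_smul' := fun r a => ?_ }, ?_⟩
  · rw [heq a (N a ⊔ N b ⊔ N (a + b)) (le_sup_left.trans le_sup_left),
      heq b (N a ⊔ N b ⊔ N (a + b)) (le_sup_right.trans le_sup_left),
      heq (a + b) (N a ⊔ N b ⊔ N (a + b)) le_sup_right, map_add]
  · rw [heq a (N a ⊔ N (r • a)) le_sup_left, heq (r • a) (N a ⊔ N (r • a)) le_sup_right, map_smul,
      RingHom.id_apply]
  · exact fun m => hN m

/-! ### Injectivity of simple modules -/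

/-- A simple module over a regular ring is injective as soon as its annihilator is the annihilator
of a finite set. A homomorphism from a left ideal `I` to `S` kills all `a ∈ I` that annihilate `S`,
since `a ∈ (a * A) * a`, so it factors through the image of `I` in a finite power of `S`. -/
theorem baer_of_isSimpleModule {A S : Type*} [Ring A] [AddCommGroup S] [Module A S]
    [IsSimpleModule A S] (hA : IsVonNeumannRegular A) (F : Finset S)
    (hF : ∀ a : A, (∀ s ∈ F, a • s = 0) → ∀ s : S, a • s = 0) : Module.Baer A S := by
  intro I g
  let φ : A →ₗ[A] F → S := LinearMap.pi fun s => LinearMap.toSpanSingleton A S s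
  let ψ : I →ₗ[A] F → S := φ ∘ₗ I.subtype
  have hker : LinearMap.ker ψ ≤ LinearMap.ker g := by
    rintro ⟨a, ha⟩ hψ
    have ha0 : ∀ s : S, a • s = 0 := hF a fun s hs => congr_fun hψ ⟨s, hs⟩
    obtain ⟨b, hb⟩ := hA a
    have : (⟨a, ha⟩ : I) = (a * b) • ⟨a, ha⟩ := Subtype.ext hb.symm
    rw [LinearMap.mem_ker, this, map_smul, mul_smul, ha0]
  obtain ⟨h, hh⟩ := IsSemisimpleModule.extension_property ((LinearMap.ker ψ).liftQ ψ le_rfl)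
    (by rw [← LinearMap.ker_eq_bot]; exact Submodule.ker_liftQ_eq_bot _ _ _ le_rfl)
    ((LinearMap.ker ψ).liftQ g hker)
  exact ⟨h ∘ₗ φ, fun a ha => LinearMap.congr_fun hh (Submodule.Quotient.mk ⟨a, ha⟩)⟩

/-- Over a regular ring with primitive factors artinian simple right modules are injective. -/
theorem baer_of_hasPrimitiveFactorsArtinian {R : Type u} {S : Type u} [Ring R] [AddCommGroup S]
    [Module Rᵐᵒᵖ S] [IsSimpleModule Rᵐᵒᵖ S] (hR : IsVonNeumannRegular R)
    (hpfa : HasPrimitiveFactorsArtinian R) : Module.Baer Rᵐᵒᵖ S := by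
  classical
  let P : TwoSidedIdeal R := TwoSidedIdeal.mk' {r | ∀ s : S, MulOpposite.op r • s = 0}
    (by simp) (fun {x y} hx hy s => by rw [MulOpposite.op_add, add_smul, hx, hy, add_zero])
    (fun {x} hx s => by rw [MulOpposite.op_neg, neg_smul, hx, neg_zero])
    (fun {x y} hy s => by rw [MulOpposite.op_mul, mul_smul, hy])
    (fun {x y} hx s => by rw [MulOpposite.op_mul, mul_smul, hx, smul_zero])
  have hP : ∀ r : R, r ∈ P ↔ ∀ s : S, MulOpposite.op r • s = 0 := fun r =>
    TwoSidedIdeal.mem_mk' _ _ _ _ _ _ _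
  obtain ⟨-, hart⟩ := hpfa P ⟨S, _, _, inferInstance, hP⟩
  -- The right ideals of `R / P` given by the annihilators of finite subsets of `S`.
  let J : Finset S → Submodule P.ringCon.Quotientᵐᵒᵖ P.ringCon.Quotient := fun F =>
    { carrier := {x | ∃ r : R, (r : P.ringCon.Quotient) = x ∧
        ∀ s ∈ F, MulOpposite.op r • s = 0}
      add_mem' := by
        rintro _ _ ⟨a, rfl, ha⟩ ⟨b, rfl, hb⟩
        exact ⟨a + b, rfl, fun s hs => by
          rw [MulOpposite.op_add, add_smul, ha s hs, hb s hs, add_zero]⟩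
      zero_mem' := ⟨0, rfl, by simp⟩
      smul_mem' := by
        rintro ⟨c⟩ _ ⟨a, rfl, ha⟩
        obtain ⟨c, rfl⟩ := RingCon.mk'_surjective P.ringCon c
        exact ⟨a * c, rfl, fun s hs => by rw [MulOpposite.op_mul, mul_smul, ha s hs, smul_zero]⟩ }
  have hJ : ∀ (F : Finset S) (r : R), (r : P.ringCon.Quotient) ∈ J F →
      ∀ s ∈ F, MulOpposite.op r • s = 0 := by
    rintro F r ⟨r', hr', h⟩ s hs
    have h1 : r' - r ∈ P := by
      rw [← TwoSidedIdeal.rel_iff]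
      exact (RingCon.eq _).1 hr'
    have h2 := (hP _).1 h1 s
    rwa [MulOpposite.op_sub, sub_smul, h s hs, zero_sub, neg_eq_zero] at h2
  obtain ⟨_, ⟨F, rfl⟩, hmin⟩ := IsArtinian.set_has_minimal (Set.range J) ⟨_, ∅, rfl⟩
  refine baer_of_isSimpleModule hR.op F fun a ha s => ?_
  have hle : J (insert s F) ≤ J F := by
    rintro _ ⟨r, rfl, hr⟩
    exact ⟨r, rfl, fun s hs => hr s (Finset.mem_insert_of_mem hs)⟩
  have heq : J (insert s F) = J F := hle.eq_of_not_lt (hmin _ ⟨_, rfl⟩)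
  refine hJ (insert s F) a.unop ?_ s (Finset.mem_insert_self s F)
  rw [heq]
  exact ⟨a.unop, rfl, ha⟩

/-! ### The two assertions on `R`-projective modules -/

/-- The ring as a right module over itself, identified with the left regular module of the
opposite ring. -/
def opEquiv (R : Type*) [Ring R] : R ≃ₗ[Rᵐᵒᵖ] Rᵐᵒᵖ where
  toFun := MulOpposite.op
  invFun := MulOpposite.unop
  map_add' _ _ := rfl
  map_smul' _ _ := rfl
  left_inv _ := rfl
  right_inv _ := rfl

theorem isEssentialRightIdeal_annRightIdeal_iff {R M : Type*} [Ring R] [AddCommGroup M]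
    [Module Rᵐᵒᵖ M] (m : M) :
    IsEssentialRightIdeal (annRightIdeal R m) ↔ IsEssential (Ideal.torsionOf Rᵐᵒᵖ M m) :=
  ⟨fun h => IsEssential.comap_equiv (opEquiv R).symm (N := annRightIdeal R m) h,
    fun h => IsEssential.comap_equiv (opEquiv R) h⟩

theorem IsRightSelfInjective.baer {R : Type*} [Ring R] (h : IsRightSelfInjective R) :
    Module.Baer Rᵐᵒᵖ Rᵐᵒᵖ :=
  (Module.Baer.of_injective (h : Module.Injective Rᵐᵒᵖ R)).of_equiv (opEquiv R)

/-- A nonzero singular element would survive in a simple quotient `R ⧸ J` of its cyclic module.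
As `R ⧸ J` is injective this extends to `M`, and it does not factor through `R`, because
homomorphisms to `R` kill singular elements. -/
theorem IsRProjective.isNonsingularRightModule {R : Type u} [Ring R] {M : Type v} [AddCommGroup M]
    [Module Rᵐᵒᵖ M] (hR : IsVonNeumannRegular R) (hpfa : HasPrimitiveFactorsArtinian R)
    (hM : IsRProjective R M) : IsNonsingularRightModule R M := by
  intro m hm
  by_contra hm0
  rw [isEssentialRightIdeal_annRightIdeal_iff] at hm
  have : Module.Finite Rᵐᵒᵖ R := Module.Finite.equiv (opEquiv R).symm
  have hne : annRightIdeal R m ≠ ⊤ := fun h => hm0 <| by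
    have h1 : (1 : R) ∈ annRightIdeal R m := h ▸ Submodule.mem_top
    simpa using (show MulOpposite.op (1 : R) • m = 0 from h1)
  obtain ⟨J, hJ, hle⟩ := (eq_top_or_exists_le_coatom (annRightIdeal R m)).resolve_left hne
  have : IsSimpleModule Rᵐᵒᵖ (R ⧸ J) := isSimpleModule_iff_isCoatom.2 hJ
  obtain ⟨f, hf⟩ := (baer_of_hasPrimitiveFactorsArtinian hR hpfa).exists_map_eq
    (m := m) (q := J.mkQ 1) fun a ha => by
      rw [Ideal.mem_torsionOf_iff, ← map_smul]
      refine (Submodule.Quotient.mk_eq_zero J).2 (hle ?_)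
      have h1 : a • (1 : R) = a.unop := one_mul _
      rw [h1]
      exact ha
  obtain ⟨g, hg⟩ := hM J f
  have hgm : g m = 0 := (opEquiv R).injective <| by
    rw [map_zero]
    exact hR.op.map_eq_zero_of_essential (↑(opEquiv R) ∘ₗ g) hm
  have h0 : J.mkQ 1 = 0 := by rw [← hf, ← hg, LinearMap.comp_apply, hgm, map_zero]
  have h1 : (1 : R) ∈ J := (Submodule.Quotient.mk_eq_zero J).1 h0
  refine hJ.1 (eq_top_iff.2 fun r _ => ?_)
  have h2 := J.smul_mem (MulOpposite.op r) h1
  rwa [op_smul_eq_mul, one_mul] at h2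

theorem IsNonsingularRightModule.projective {R : Type u} [Ring R] {M : Type v} [AddCommGroup M]
    [Module Rᵐᵒᵖ M] (hR : IsVonNeumannRegular R) (hinj : IsRightSelfInjective R)
    (hM : IsNonsingularRightModule R M) (hcg : IsCountablyGenerated R M) :
    Module.Projective Rᵐᵒᵖ M := by
  obtain ⟨S, hS, hspan⟩ := hcg
  refine projective_of_exists_functional_smul_eq
    (exists_functional_smul_eq hR.op hinj.baer fun m hm => ?_) hS hspan
  exact hM m ((isEssentialRightIdeal_annRightIdeal_iff m).2 hm)

/-! ### Products of skew-fields -/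

theorem isArtinian_of_smul_surjective {A M : Type*} [Ring A] [AddCommGroup M] [Module A M]
    (h : ∀ m : M, m ≠ 0 → ∀ x : M, ∃ a : A, a • m = x) : IsArtinian A M := by
  rcases subsingleton_or_nontrivial M with _ | _
  · infer_instance
  · have : IsSimpleModule A M :=
      isSimpleModule_iff_toSpanSingleton_surjective.2 ⟨inferInstance, fun m hm x => h m hm x⟩
    infer_instance

section Pi

variable {ι : Type*} (D : ι → Type*) [∀ i, DivisionRing (D i)]

theorem isVonNeumannRegular_pi : IsVonNeumannRegular (∀ i, D i) := fun a =>
  ⟨a⁻¹, funext fun i => by simp⟩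

/-- A homomorphism `g` from a right ideal is left multiplication by the element whose `i`-th
coordinate is read off from the value of `g` at the `i`-th unit vector, if that lies in the
ideal, and is zero otherwise. -/
theorem isRightSelfInjective_pi : IsRightSelfInjective (∀ i, D i) := by
  classical
  refine Module.Baer.injective fun I g => ?_
  let δ : ∀ i, (∀ i, D i)ᵐᵒᵖ := fun i => MulOpposite.op (Pi.single i 1)
  let c : ∀ i, D i := fun i => if h : δ i ∈ I then g ⟨δ i, h⟩ i else 0
  refine ⟨⟨⟨fun x => c * x.unop, fun x y => by simp [mul_add]⟩,
    fun r x => by simp [mul_assoc]⟩, fun x hx => funext fun i => ?_⟩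
  have hcomm : ∀ y : (∀ i, D i)ᵐᵒᵖ, y * δ i = δ i * y := fun y =>
    MulOpposite.unop_injective <| funext fun j => by
      rcases eq_or_ne j i with rfl | hj
      · simp [δ]
      · simp [δ, hj]
  have hgi : g ⟨x, hx⟩ i = g ⟨δ i * x, I.mul_mem_left _ hx⟩ i := by
    have : (⟨δ i * x, I.mul_mem_left _ hx⟩ : I) = δ i • ⟨x, hx⟩ := rfl
    rw [this, map_smul]
    simp [δ]
  change c i * x.unop i = _
  rw [hgi]
  by_cases h : δ i ∈ I
  · have : (⟨δ i * x, I.mul_mem_left _ hx⟩ : I) = x • ⟨δ i, h⟩ := Subtype.ext (hcomm x).symm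
    rw [this, map_smul]
    simp [c, h, MulOpposite.smul_eq_mul_unop]
  · have hxi : x.unop i = 0 := by
      by_contra hne
      refine h ?_
      have : δ i = MulOpposite.op (Pi.single i (x.unop i)⁻¹) * x :=
        MulOpposite.unop_injective <| funext fun j => by
          rcases eq_or_ne j i with rfl | hj
          · simp [δ, hne]
          · simp [δ, hj]
      rw [this]
      exact I.mul_mem_left _ hx
    have h0 : δ i * x = 0 := MulOpposite.unop_injective <| funext fun j => by
      rcases eq_or_ne j i with rfl | hj
      · simp [δ, hxi]
      · simp [δ, hj]
    have : (⟨δ i * x, I.mul_mem_left _ hx⟩ : I) = 0 := Subtype.ext h0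
    rw [this, map_zero, hxi, mul_zero]
    rfl

/-- The idempotents `x * x⁻¹` are central, so one of `x * x⁻¹` and `1 - x * x⁻¹` kills a given simple
module; hence the primitive factors are skew-fields. -/
theorem hasPrimitiveFactorsArtinian_pi : HasPrimitiveFactorsArtinian (∀ i, D i) := by
  rintro P ⟨S, _, _, hS, hP⟩
  have hcomm : ∀ x y : ∀ i, D i, x * x⁻¹ * y = y * (x * x⁻¹) := fun x y => funext fun i => by
    by_cases h : x i = 0 <;> simp [h]
  have key : ∀ x : ∀ i, D i, x ∉ P → 1 - x * x⁻¹ ∈ P := fun x hx => by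
    -- The elements of `S` killed by `1 - x * x⁻¹` form a submodule, as `x * x⁻¹` is central.
    let T : Submodule (∀ i, D i)ᵐᵒᵖ S :=
      { carrier := {s | MulOpposite.op (1 - x * x⁻¹) • s = 0}
        add_mem' := fun {a b} ha hb => by
          change _ • (a + b) = 0
          rw [smul_add, show _ • a = 0 from ha, show _ • b = 0 from hb, add_zero]
        zero_mem' := smul_zero _
        smul_mem' := fun r a ha => by
          change _ • r • a = 0
          have : MulOpposite.op (1 - x * x⁻¹) * r = r * MulOpposite.op (1 - x * x⁻¹) :=
            MulOpposite.unop_injective (by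
              simp only [MulOpposite.unop_mul, MulOpposite.unop_op]
              rw [mul_sub, sub_mul, hcomm, one_mul, mul_one])
          rw [← mul_smul, this, mul_smul, show _ • a = 0 from ha, smul_zero] }
    rcases eq_bot_or_eq_top T with hT | hT
    · refine absurd ((hP x).2 fun s => ?_) hx
      have : MulOpposite.op x • s ∈ T := by
        change _ • _ • s = 0
        rw [← mul_smul, ← MulOpposite.op_mul, mul_sub, mul_one, ← hcomm,
          show x * x⁻¹ * x = x from funext fun i => by simp, sub_self, MulOpposite.op_zero, zero_smul]
      rwa [hT] at this
    · exact (hP _).2 fun s => (hT ▸ Submodule.mem_top : s ∈ T)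
  have hmk : ∀ x : ∀ i, D i, (x : P.ringCon.Quotient) ≠ 0 →
      (x : P.ringCon.Quotient) * (x⁻¹ : ∀ i, D i) = 1 := fun x hx => by
    have h1 : 1 - x * x⁻¹ ∈ P := key x fun h => hx ((RingCon.eq _).2 ((P.mem_iff x).1 h))
    rw [← TwoSidedIdeal.rel_iff] at h1
    exact ((RingCon.eq _).2 h1).symm
  have hcomm' : ∀ x : ∀ i, D i, x⁻¹ * x = x * x⁻¹ := fun x => funext fun i => by
    by_cases h : x i = 0 <;> simp [h]
  constructor
  · refine isArtinian_of_smul_surjective fun m hm y => ?_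
    obtain ⟨m, rfl⟩ := RingCon.mk'_surjective P.ringCon m
    refine ⟨y * ((m⁻¹ : ∀ i, D i) : P.ringCon.Quotient), ?_⟩
    have h1 := hmk m hm
    rw [← RingCon.coe_mul, ← hcomm', RingCon.coe_mul] at h1
    rw [smul_eq_mul, mul_assoc]
    exact (congrArg (y * ·) h1).trans (mul_one y)
  · refine isArtinian_of_smul_surjective fun m hm y => ?_
    obtain ⟨m, rfl⟩ := RingCon.mk'_surjective P.ringCon m
    refine ⟨MulOpposite.op (((m⁻¹ : ∀ i, D i) : P.ringCon.Quotient) * y), ?_⟩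
    rw [op_smul_eq_mul, ← mul_assoc]
    exact (congrArg (· * y) (hmk m hm)).trans (one_mul y)

/-- The left ideals of elements vanishing at the first `n` indices of a sequence in `ι` form a
strictly decreasing chain. -/
theorem not_isTwoSidedArtinian_pi [Infinite ι] : ¬ IsTwoSidedArtinian (∀ i, D i) := by
  classical
  rintro ⟨hart, -⟩
  let e := Infinite.natEmbedding ι
  let V : ℕ →o (Submodule (∀ i, D i) (∀ i, D i))ᵒᵈ :=
    { toFun := fun n => OrderDual.toDual
        { carrier := {x | ∀ k < n, x (e k) = 0}
          add_mem' := fun {a b} ha hb k hk => by simp [ha k hk, hb k hk]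
          zero_mem' := fun k hk => rfl
          smul_mem' := fun r x hx k hk => by simp [hx k hk] }
      monotone' := fun m n hmn x hx k hk => hx k (hk.trans_le hmn) }
  obtain ⟨n, hn⟩ := IsArtinian.monotone_stabilizes V
  have h1 : (Pi.single (e n) 1 : ∀ i, D i) ∈ OrderDual.ofDual (V n) := fun k hk =>
    Pi.single_eq_of_ne (e.injective.ne hk.ne) _
  rw [hn (n + 1) n.le_succ] at h1
  have h2 := h1 n n.lt_succ_self
  simp at h2

end Pi

end DualBaer

theorem mainTheorem5 :
    (∀ (R : Type*) [Ring R], DualBaer.IsNonArtinianRegularSelfInjective R →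
      (∀ (M : Type*) [AddCommGroup M] [Module Rᵐᵒᵖ M],
        DualBaer.IsRProjective R M → DualBaer.IsNonsingularRightModule R M) ∧
      (∀ (M : Type*) [AddCommGroup M] [Module Rᵐᵒᵖ M],
        DualBaer.IsCountablyGenerated R M →
          (Module.Projective Rᵐᵒᵖ M ↔ DualBaer.IsRProjective R M))) ∧
    (∀ (ι : Type*) [Infinite ι] (D : ι → Type*) [∀ i, DivisionRing (D i)],
      DualBaer.IsNonArtinianRegularSelfInjective (∀ i, D i)) := by
  refine ⟨fun R _ hR => ⟨fun M _ _ hM =>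
    hM.isNonsingularRightModule hR.regular hR.primitiveFactorsArtinian,
    fun M _ _ hcg => ⟨fun _ I f => Module.projective_lifting_property _ _ I.mkQ_surjective,
      fun hM => (hM.isNonsingularRightModule hR.regular hR.primitiveFactorsArtinian).projective
        hR.regular hR.selfInjective hcg⟩⟩, fun ι _ D _ => ?_⟩
  exact ⟨DualBaer.isRightSelfInjective_pi D, DualBaer.isVonNeumannRegular_pi D,
    DualBaer.hasPrimitiveFactorsArtinian_pi D, DualBaer.not_isTwoSidedArtinian_pi D⟩
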